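/- Let $d\ge 1$ and $N\ge 1$ be integers. For $x=(x_1,\dots,x_N)\in(\mathbb{R}^d)^N$ let $$c(x_1,\dots,x_N)=\sum_{1\le i<j\le N}\frac{1}{|x_i-x_j|}\in[0,+\infty]$$ be the Coulomb cost (with $1/0=+\infty$). For a Borel probability measure $\rho$ on $\mathbb{R}^d$ let $$C(\rho)=\inf\left\{\int_{(\mathbb{R}^d)^N}c\,dP\ :\ P\in\Pi(\rho)\right\}\in[0,+\infty],$$ where $\Pi(\rho)$ is the set of Borel probability measures $P$ on $(\mathbb{R}^d)^N$ all of whose $N$ marginals on $\mathbb{R}^d$ are equal to $\rho$. For a sub-probability $\rho$ on $\mathbb{R}^d$, that is, a nonnegative Borel measure of total mass $\|\rho\|=\rho(\mathbb{R}^d)\le 1$, let $$\overline{C}(\rho)=\inf\left\{\liminf_{n\to\infty} C(\rho_n)\ :\ \rho_n\stackrel{*}{\rightharpoonup}\rho,\ \rho_n \text{ Borel probability measures on } \mathbb{R}^d\right\},$$ where $\rho_n\stackrel{*}{\rightharpoonup}\rho$ means $\int\varphi\,d\rho_n\to\int\varphi\,d\rho$ for every continuous function $\varphi:\mathbb{R}^d\to\mathbb{R}$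 vanishing at infinity. Then, for every sub-probability $\rho$ on $\mathbb{R}^d$, $$\overline{C}(\rho)=0\quad\text{if and only if}\quad\|\rho\|\le\frac1N.$$ -/

import Mathlib

open MeasureTheory Filter Topology
open scoped ENNReal ZeroAtInfty

/-- The Coulomb cost `c(x₁, …, x_N) = ∑_{i < j} 1 / |x_i - x_j|` on `(ℝ^d)^N`, with values in
`[0, +∞]`: a term is `+∞` when `x_i = x_j`. -/
noncomputable def coulombCost {d : ℕ} (N : ℕ) (x : Fin N → EuclideanSpace ℝ (Fin d)) : ℝ≥0∞ :=
  ∑ i : Fin N, ∑ j ∈ Finset.Ioi i, 1 / ‖x i - x j‖ₑ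

/-- The multi-marginal transport plans `Π(ρ)`: Borel probabilities on `(ℝ^d)^N`
all of whose `N` marginals are equal to `ρ`. -/
def transportPlans {d : ℕ} (N : ℕ) (ρ : Measure (EuclideanSpace ℝ (Fin d))) :
    Set (Measure (Fin N → EuclideanSpace ℝ (Fin d))) :=
  {P | IsProbabilityMeasure P ∧ ∀ i : Fin N, P.map (fun x => x i) = ρ}

/-- The electron-electron interaction functional `C(ρ) = inf {∫ c dP : P ∈ Π(ρ)}`. -/
noncomputable def multimarginalCost {d : ℕ} (N : ℕ)
    (ρ : Measure (EuclideanSpace ℝ (Fin d))) : ℝ≥0∞ :=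
  ⨅ P ∈ transportPlans N ρ, ∫⁻ x, coulombCost N x ∂P

/-- The sub-probabilities `𝒫⁻` on `ℝ^d`: nonnegative Borel measures of mass at most `1`. -/
def subProbabilities (d : ℕ) : Set (Measure (EuclideanSpace ℝ (Fin d))) :=
  {ρ | ρ Set.univ ≤ 1}

/-- Weak* convergence of a sequence of measures, that is, convergence in the duality with the
space `C₀` of continuous functions vanishing at infinity (mass may escape to infinity). -/
def WeakStarTendsto {d : ℕ} (ρs : ℕ → Measure (EuclideanSpace ℝ (Fin d)))
    (ρ : Measure (EuclideanSpace ℝ (Fin d))) : Prop :=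
  ∀ φ : C₀(EuclideanSpace ℝ (Fin d), ℝ),
    Tendsto (fun n => ∫ x, φ x ∂(ρs n)) atTop (𝓝 (∫ x, φ x ∂ρ))

/-- The relaxed cost
`C̄(ρ) = inf {liminf_n C(ρ_n) : ρ_n weakly* convergent to ρ, ρ_n probabilities}`. -/
noncomputable def relaxedCost {d : ℕ} (N : ℕ)
    (ρ : Measure (EuclideanSpace ℝ (Fin d))) : ℝ≥0∞ :=
  ⨅ (ρs : ℕ → Measure (EuclideanSpace ℝ (Fin d))) (_ : ∀ n, IsProbabilityMeasure (ρs n))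
    (_ : WeakStarTendsto ρs ρ), liminf (fun n => multimarginalCost N (ρs n)) atTop

/-! Two particles in a ball of radius `R` cost at least `1 / (2 * R)`, so a cheap plan seldom puts
more than one of its `N` particles there. Averaging over a plan bounds `N * ρ (closedBall 0 R)` by
`1` plus a multiple of the cost. The bound survives weak* limits
(`mul_measure_closedBall_le_relaxedCost`), and at zero relaxed cost `R` can go to infinity.
Conversely, if the mass is at most `1 / N`, pad `ρ` to mass exactly `1 / N` and superpose `N`
translates of it along a long vector `v`. The cyclic plan keeps particles at distance at least
`‖v‖`, so its cost vanishes as `v` goes to infinity, while only the untranslated copy of `ρ` stays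
in the weak* limit. -/

/-! ### Zero relaxed cost forces mass at most `1 / N`. -/

section Necessity

variable {d N : ℕ}

/-- Two particles in the ball of radius `R` interact with energy at least `1 / (2 * R)`, so the
number of particles in that ball is controlled by the cost. -/
lemma sum_indicator_closedBall_le (R : ℝ) (hR : 0 < R) (x : Fin N → EuclideanSpace ℝ (Fin d)) :
    ∑ i, (Metric.closedBall (0 : EuclideanSpace ℝ (Fin d)) R).indicator (1 : EuclideanSpace ℝ (Fin d) → ℝ≥0∞) (x i)
      ≤ 1 + N * ENNReal.ofReal (2 * R) * coulombCost N x := by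
  classical
  set B := Metric.closedBall (0 : EuclideanSpace ℝ (Fin d)) R
  have hsum : ∑ i, B.indicator (1 : EuclideanSpace ℝ (Fin d) → ℝ≥0∞) (x i)
      = ((Finset.univ.filter fun i => x i ∈ B).card : ℝ≥0∞) := by
    simp [Set.indicator_apply]
  rw [hsum]
  by_cases h : (Finset.univ.filter fun i => x i ∈ B).card ≤ 1
  · exact le_add_right (by exact_mod_cast h)
  · obtain ⟨i, hi, j, hj, hij⟩ := Finset.one_lt_card.1 (not_le.1 h)
    simp only [Finset.mem_filter, Finset.mem_univ, true_and] at hi hj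
    wlog hlt : i < j generalizing i j
    · exact this j i hij.symm hj hi (lt_of_le_of_ne (not_lt.1 hlt) hij.symm)
    have hterm : 1 / ‖x i - x j‖ₑ ≤ coulombCost N x :=
      (Finset.single_le_sum (f := fun j => 1 / ‖x i - x j‖ₑ) (fun _ _ => zero_le)
        (Finset.mem_Ioi.2 hlt)).trans
        (Finset.single_le_sum (f := fun i => ∑ j ∈ Finset.Ioi i, 1 / ‖x i - x j‖ₑ)
          (fun _ _ => zero_le) (Finset.mem_univ i))
    have hdist : ‖x i - x j‖ₑ ≤ ENNReal.ofReal (2 * R) := by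
      rw [← ofReal_norm]
      refine ENNReal.ofReal_le_ofReal ((norm_sub_le _ _).trans ?_)
      have h1 := mem_closedBall_zero_iff.1 hi
      have h2 := mem_closedBall_zero_iff.1 hj
      linarith
    have hone : 1 ≤ ENNReal.ofReal (2 * R) * coulombCost N x := by
      calc (1 : ℝ≥0∞) = ENNReal.ofReal (2 * R) * (ENNReal.ofReal (2 * R))⁻¹ :=
            (ENNReal.mul_inv_cancel (by simpa using hR) ENNReal.ofReal_ne_top).symm
        _ ≤ ENNReal.ofReal (2 * R) * (1 / ‖x i - x j‖ₑ) := by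
            rw [one_div]; gcongr
        _ ≤ _ := by gcongr
    have hcard : ((Finset.univ.filter fun i => x i ∈ B).card : ℝ≥0∞) ≤ N := by
      exact_mod_cast (Finset.card_le_univ _).trans (by simp)
    calc _ ≤ (N : ℝ≥0∞) * 1 := by simpa using hcard
      _ ≤ N * (ENNReal.ofReal (2 * R) * coulombCost N x) := by gcongr
      _ ≤ _ := by rw [mul_assoc]; exact le_add_left le_rfl

lemma mul_measure_closedBall_le (R : ℝ) (hR : 0 < R) (ρ : Measure (EuclideanSpace ℝ (Fin d))) :
    N * ρ (Metric.closedBall 0 R)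
      ≤ 1 + N * ENNReal.ofReal (2 * R) * multimarginalCost N ρ := by
  have hC : N * ENNReal.ofReal (2 * R) ≠ ∞ :=
    ENNReal.mul_ne_top (ENNReal.natCast_ne_top N) ENNReal.ofReal_ne_top
  rcases eq_or_ne N 0 with rfl | hN
  · simp
  have h0 : N * ENNReal.ofReal (2 * R) ≠ 0 := by simp [hN, hR]
  rw [multimarginalCost, ENNReal.mul_iInf_of_ne h0 hC, ENNReal.add_iInf]
  refine le_iInf fun P => ?_
  rw [ENNReal.mul_iInf_of_ne h0 hC]
  -- For `P` that is not a plan the inner infimum is `∞`, and its coefficient is nonzero.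
  by_cases hP : P ∈ transportPlans N ρ
  swap
  · simp [hP]
  simp only [hP, iInf_pos]
  obtain ⟨hprob, hmarg⟩ := hP
  have hB : MeasurableSet (Metric.closedBall (0 : EuclideanSpace ℝ (Fin d)) R) :=
    Metric.isClosed_closedBall.measurableSet
  have hi : ∀ i : Fin N, ∫⁻ x : Fin N → EuclideanSpace ℝ (Fin d),
      (Metric.closedBall (0 : EuclideanSpace ℝ (Fin d)) R).indicator (1 : EuclideanSpace ℝ (Fin d) → ℝ≥0∞) (x i) ∂P
        = ρ (Metric.closedBall 0 R) := fun i => by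
    rw [← lintegral_map (f := (Metric.closedBall (0 : EuclideanSpace ℝ (Fin d)) R).indicator 1)
      (measurable_one.indicator hB) (measurable_pi_apply i), hmarg i, lintegral_indicator_one hB]
  calc (N : ℝ≥0∞) * ρ (Metric.closedBall 0 R)
      = ∫⁻ x : Fin N → EuclideanSpace ℝ (Fin d), ∑ i,
        (Metric.closedBall (0 : EuclideanSpace ℝ (Fin d)) R).indicator (1 : EuclideanSpace ℝ (Fin d) → ℝ≥0∞) (x i) ∂P := by
        rw [lintegral_finsetSum]
        · simp [hi]
        · exact fun i _ => (measurable_one.indicator hB).comp (measurable_pi_apply i)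
    _ ≤ ∫⁻ x, (1 + N * ENNReal.ofReal (2 * R) * coulombCost N x) ∂P :=
        lintegral_mono (sum_indicator_closedBall_le R hR)
    _ = _ := by
        rw [lintegral_add_left measurable_const, lintegral_const_mul' _ _ hC]
        simp

/-- A function of `C₀` squeezed between the indicators of two concentric balls. -/
lemma exists_zeroAtInfty_cutoff (R : ℝ) (hR : 0 < R) :
    ∃ φ : C₀(EuclideanSpace ℝ (Fin d), ℝ),
      (Metric.closedBall 0 R).indicator 1 ≤ (φ : EuclideanSpace ℝ (Fin d) → ℝ) ∧
      (φ : EuclideanSpace ℝ (Fin d) → ℝ) ≤ (Metric.closedBall 0 (2 * R)).indicator 1 := by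
  obtain ⟨f, hf1, hf0, hfc, hf⟩ := exists_continuous_one_zero_of_isCompact
    (isCompact_closedBall (0 : EuclideanSpace ℝ (Fin d)) R)
    (t := (Metric.ball (0 : EuclideanSpace ℝ (Fin d)) (2 * R))ᶜ)
    (Metric.isOpen_ball.isClosed_compl)
    (Set.disjoint_compl_right_iff_subset.2 (Metric.closedBall_subset_ball (by linarith)))
  refine ⟨⟨f, hfc.is_zero_at_infty⟩, fun x => ?_, fun x => ?_⟩
  · change _ ≤ f x
    by_cases hx : x ∈ Metric.closedBall 0 R
    · rw [Set.indicator_of_mem hx, hf1 hx]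
    · rw [Set.indicator_of_notMem hx]; exact (hf x).1
  · change f x ≤ _
    by_cases hx : x ∈ Metric.closedBall 0 (2 * R)
    · rw [Set.indicator_of_mem hx]; exact (hf x).2
    · rw [Set.indicator_of_notMem hx]
      exact (hf0 fun h => hx (Metric.ball_subset_closedBall h)).le

lemma measure_closedBall_le_liminf {ρ : Measure (EuclideanSpace ℝ (Fin d))} [IsFiniteMeasure ρ]
    {ρs : ℕ → Measure (EuclideanSpace ℝ (Fin d))} (hρs : ∀ n, IsProbabilityMeasure (ρs n))
    (h : WeakStarTendsto ρs ρ) (R : ℝ) (hR : 0 < R) :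
    ρ (Metric.closedBall 0 R) ≤ liminf (fun n => ρs n (Metric.closedBall 0 (2 * R))) atTop := by
  obtain ⟨φ, h1, h2⟩ := exists_zeroAtInfty_cutoff (d := d) R hR
  have hint : ∀ (μ : Measure (EuclideanSpace ℝ (Fin d))) [IsFiniteMeasure μ], Integrable φ μ :=
    fun μ _ => φ.toBCF.integrable μ
  have hlow : ρ (Metric.closedBall 0 R) ≤ ENNReal.ofReal (∫ x, φ x ∂ρ) := by
    rw [← ofReal_measureReal, ← integral_indicator_one Metric.isClosed_closedBall.measurableSet]
    refine ENNReal.ofReal_le_ofReal (integral_mono ?_ (hint ρ) h1)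
    exact (integrable_const (1 : ℝ)).indicator Metric.isClosed_closedBall.measurableSet
  have hup : ∀ n, ENNReal.ofReal (∫ x, φ x ∂ρs n) ≤ ρs n (Metric.closedBall 0 (2 * R)) := fun n => by
    have := hρs n
    rw [← ofReal_measureReal (μ := ρs n),
      ← integral_indicator_one Metric.isClosed_closedBall.measurableSet]
    refine ENNReal.ofReal_le_ofReal (integral_mono (hint (ρs n)) ?_ h2)
    exact (integrable_const (1 : ℝ)).indicator Metric.isClosed_closedBall.measurableSet
  refine hlow.trans ?_
  rw [← ((ENNReal.continuous_ofReal.tendsto _).comp (h φ)).liminf_eq]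
  exact liminf_le_liminf (Eventually.of_forall hup)

/-- The cutoff doubles the radius, hence `2 * (2 * R)` in place of `2 * R`. -/
lemma mul_measure_closedBall_le_relaxedCost {ρ : Measure (EuclideanSpace ℝ (Fin d))}
    [IsFiniteMeasure ρ] (hN : 1 ≤ N) (R : ℝ) (hR : 0 < R) :
    N * ρ (Metric.closedBall 0 R)
      ≤ 1 + N * ENNReal.ofReal (2 * (2 * R)) * relaxedCost N ρ := by
  set K : ℝ≥0∞ := N * ENNReal.ofReal (2 * (2 * R)) with hK
  have hC : K ≠ ∞ := ENNReal.mul_ne_top (ENNReal.natCast_ne_top N) ENNReal.ofReal_ne_top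
  have h0 : K ≠ 0 := by
    have : N ≠ 0 := by omega
    simp [hK, this, hR]
  refine le_of_forall_gt fun a ha => ?_
  -- The slack `b` avoids having to attain the infimum: some admissible sequence has cost below `b`
  -- infinitely often, which is enough to bound a liminf of masses.
  obtain ⟨b, hb, hba⟩ : ∃ b, relaxedCost N ρ < b ∧ 1 + K * b < a := by
    have hcont : ContinuousAt (fun t : ℝ≥0∞ => 1 + K * t) (relaxedCost N ρ) :=
      ((ENNReal.continuous_const_mul hC).const_add 1).continuousAt
    have hev := hcont.eventually_lt continuousAt_const ha
    have hlt : relaxedCost N ρ < ∞ := by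
      by_contra htop
      rw [not_lt, top_le_iff] at htop
      rw [htop, ENNReal.mul_top h0, add_top] at ha
      exact not_top_lt ha
    have : (𝓝[>] relaxedCost N ρ).NeBot := nhdsGT_neBot_of_exists_gt ⟨∞, hlt⟩
    obtain ⟨b, hb1, hb2⟩ := ((hev.filter_mono nhdsWithin_le_nhds).and
      (self_mem_nhdsWithin (s := Set.Ioi (relaxedCost N ρ)))).exists
    exact ⟨b, hb2, hb1⟩
  simp only [relaxedCost, iInf_lt_iff] at hb
  obtain ⟨ρs, hprob, hconv, hlim⟩ := hb
  have hfreq := frequently_lt_of_liminf_lt (by isBoundedDefault) hlim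
  refine lt_of_le_of_lt ?_ hba
  have hN0 : (N : ℝ≥0∞) ≠ 0 := by exact_mod_cast (by omega : N ≠ 0)
  rw [mul_comm, ← ENNReal.le_div_iff_mul_le (Or.inl hN0) (Or.inl (ENNReal.natCast_ne_top N))]
  refine (measure_closedBall_le_liminf hprob hconv R hR).trans
    (liminf_le_of_frequently_le (hfreq.mono fun n hn => ?_) (by isBoundedDefault))
  rw [ENNReal.le_div_iff_mul_le (Or.inl hN0) (Or.inl (ENNReal.natCast_ne_top N)), mul_comm]
  exact (mul_measure_closedBall_le (2 * R) (by linarith) (ρs n)).trans (by gcongr)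

lemma measure_univ_le_of_relaxedCost_eq_zero {ρ : Measure (EuclideanSpace ℝ (Fin d))}
    [IsFiniteMeasure ρ] (hN : 1 ≤ N) (h : relaxedCost N ρ = 0) :
    ρ Set.univ ≤ 1 / (N : ℝ≥0∞) := by
  have hN0 : (N : ℝ≥0∞) ≠ 0 := by exact_mod_cast (by omega : N ≠ 0)
  have hmono : Monotone fun n : ℕ =>
      Metric.closedBall (0 : EuclideanSpace ℝ (Fin d)) ((n : ℝ) + 1) := fun m n hmn =>
    Metric.closedBall_subset_closedBall (by gcongr)
  have huniv : ⋃ n : ℕ, Metric.closedBall (0 : EuclideanSpace ℝ (Fin d)) ((n : ℝ) + 1)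
      = Set.univ := by
    refine Set.eq_univ_of_forall fun x => Set.mem_iUnion.2 ?_
    obtain ⟨n, hn⟩ := exists_nat_ge ‖x‖
    exact ⟨n, mem_closedBall_zero_iff.2 (by linarith)⟩
  rw [← huniv, hmono.measure_iUnion]
  refine iSup_le fun n => ?_
  rw [ENNReal.le_div_iff_mul_le (Or.inl hN0) (Or.inl (ENNReal.natCast_ne_top N)), mul_comm]
  simpa [h] using mul_measure_closedBall_le_relaxedCost (N := N) (ρ := ρ) hN ((n : ℝ) + 1)
    (by positivity)

end Necessity

/-! ### Mass at most `1 / N` allows particles to escape at vanishing cost. -/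

section Sufficiency

variable {d N : ℕ}

lemma coulombCost_le_of_separated {r : ℝ≥0∞} {x : Fin N → EuclideanSpace ℝ (Fin d)}
    (hx : ∀ i j, i ≠ j → r ≤ ‖x i - x j‖ₑ) : coulombCost N x ≤ N * N * r⁻¹ := by
  calc coulombCost N x ≤ ∑ _i : Fin N, ∑ _j : Fin N, r⁻¹ := by
        refine Finset.sum_le_sum fun i _ => ?_
        refine (Finset.sum_le_sum fun j hj => ?_).trans
          (Finset.sum_le_sum_of_subset (Finset.subset_univ _))
        rw [one_div]
        exact ENNReal.inv_le_inv.2 (hx i j (Finset.mem_Ioi.1 hj).ne)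
    _ = _ := by simp [mul_assoc]

/-- The superposition of the translates of `μ` by `0, v, …, (N - 1) • v`. -/
noncomputable def translateSum (N : ℕ) (μ : Measure (EuclideanSpace ℝ (Fin d)))
    (v : EuclideanSpace ℝ (Fin d)) : Measure (EuclideanSpace ℝ (Fin d)) :=
  ∑ k : Fin N, μ.map fun x => x + (k : ℝ) • v

/-- The plan with marginals `translateSum N μ v` that places the particles at cyclic permutations
of `x, x + v, …, x + (N - 1) • v`, where `x` is distributed according to `μ`. -/
noncomputable def cyclicPlan (N : ℕ) [NeZero N] (μ : Measure (EuclideanSpace ℝ (Fin d)))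
    (v : EuclideanSpace ℝ (Fin d)) : Measure (Fin N → EuclideanSpace ℝ (Fin d)) :=
  ∑ k : Fin N, μ.map fun x i => x + ((i + k : Fin N) : ℝ) • v

lemma measurable_cyclicShift [NeZero N] (v : EuclideanSpace ℝ (Fin d)) (k : Fin N) :
    Measurable fun (x : EuclideanSpace ℝ (Fin d)) (i : Fin N) => x + ((i + k : Fin N) : ℝ) • v :=
  measurable_pi_lambda _ fun _ => measurable_id.add_const _

lemma cyclicPlan_mem_transportPlans [NeZero N] {μ : Measure (EuclideanSpace ℝ (Fin d))}
    (hμ : N * μ Set.univ = 1) (v : EuclideanSpace ℝ (Fin d)) :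
    cyclicPlan N μ v ∈ transportPlans N (translateSum N μ v) := by
  refine ⟨⟨?_⟩, fun i => ?_⟩
  · simp only [cyclicPlan, Measure.coe_finsetSum, Finset.sum_apply]
    simp [Measure.map_apply (measurable_cyclicShift v _), hμ]
  · rw [cyclicPlan, translateSum, Measure.map_finset_sum (measurable_pi_apply i).aemeasurable]
    -- For fixed `i`, the index `i + k` runs over all of `Fin N`, so each marginal contains every
    -- translate once.
    refine (Finset.sum_congr rfl fun k _ => ?_).trans (Equiv.sum_comp (Equiv.addLeft i)
      fun k : Fin N => μ.map fun x => x + (k : ℝ) • v)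
    rw [Measure.map_map (measurable_pi_apply i) (measurable_cyclicShift v k)]
    rfl

lemma isProbabilityMeasure_translateSum {μ : Measure (EuclideanSpace ℝ (Fin d))}
    (hμ : N * μ Set.univ = 1) (v : EuclideanSpace ℝ (Fin d)) :
    IsProbabilityMeasure (translateSum N μ v) := by
  refine ⟨?_⟩
  simp only [translateSum, Measure.coe_finsetSum, Finset.sum_apply]
  simp [Measure.map_apply (measurable_add_const _), hμ]

lemma multimarginalCost_translateSum_le [NeZero N] {μ : Measure (EuclideanSpace ℝ (Fin d))}
    (hμ : N * μ Set.univ = 1) (v : EuclideanSpace ℝ (Fin d)) :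
    multimarginalCost N (translateSum N μ v) ≤ N * N * ‖v‖ₑ⁻¹ := by
  have hmem := cyclicPlan_mem_transportPlans hμ v
  have : IsProbabilityMeasure (cyclicPlan N μ v) := hmem.1
  have hcost : ∀ᵐ x ∂cyclicPlan N μ v, coulombCost N x ≤ N * N * ‖v‖ₑ⁻¹ := by
    have hcl : MeasurableSet
        {x : Fin N → EuclideanSpace ℝ (Fin d) | ∀ i j, i ≠ j → ‖v‖ₑ ≤ ‖x i - x j‖ₑ} := by
      simp only [Set.ofPred_forall]
      refine MeasurableSet.iInter fun i => MeasurableSet.iInter fun j => MeasurableSet.iInter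
        fun _ => measurableSet_le measurable_const ?_
      fun_prop
    have hsep : ∀ᵐ x ∂cyclicPlan N μ v, ∀ i j, i ≠ j → ‖v‖ₑ ≤ ‖x i - x j‖ₑ := by
      rw [cyclicPlan, ← Measure.sum_fintype, Measure.ae_sum_iff' hcl]
      refine fun k => (ae_map_iff (measurable_cyclicShift v k).aemeasurable hcl).2
        (Eventually.of_forall fun x i j hij => ?_)
      -- Addition wraps modulo `N` but stays injective, so the multiples of `v` are distinct
      -- integers and differ by at least `1`.
      have hne : ((i + k : Fin N) : ℕ) ≠ ((j + k : Fin N) : ℕ) := fun h =>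
        hij (add_right_cancel (Fin.ext h))
      have habs : (1 : ℝ) ≤ |((i + k : Fin N) : ℝ) - ((j + k : Fin N) : ℝ)| := by
        have : (1 : ℤ) ≤ |(((i + k : Fin N) : ℕ) : ℤ) - (((j + k : Fin N) : ℕ) : ℤ)| :=
          Int.one_le_abs (sub_ne_zero.2 (by exact_mod_cast hne))
        exact_mod_cast this
      rw [add_sub_add_left_eq_sub, ← sub_smul, enorm_le_iff_norm_le, norm_smul, Real.norm_eq_abs]
      exact le_mul_of_one_le_left (norm_nonneg _) habs
    exact hsep.mono fun x hx => coulombCost_le_of_separated hx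
  refine (iInf₂_le _ hmem).trans ((lintegral_mono_ae hcost).trans ?_)
  simp

lemma integral_translateSum (μ : Measure (EuclideanSpace ℝ (Fin d))) [IsFiniteMeasure μ]
    (v : EuclideanSpace ℝ (Fin d)) (φ : C₀(EuclideanSpace ℝ (Fin d), ℝ)) :
    ∫ x, φ x ∂translateSum N μ v = ∑ k : Fin N, ∫ x, φ (x + (k : ℝ) • v) ∂μ := by
  rw [translateSum, integral_finsetSum_measure]
  · refine Finset.sum_congr rfl fun k _ => ?_
    exact integral_map (measurable_add_const _).aemeasurable φ.continuous.aestronglyMeasurable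
  · exact fun k _ => φ.toBCF.integrable _

/-- The vector of length `n + 1` in the direction `e`. -/
noncomputable def escapeVector (e : EuclideanSpace ℝ (Fin d)) (n : ℕ) :
    EuclideanSpace ℝ (Fin d) := ((n : ℝ) + 1) • e

lemma tendsto_zeroAtInfty_escape {e : EuclideanSpace ℝ (Fin d)} (he : ‖e‖ = 1)
    (φ : C₀(EuclideanSpace ℝ (Fin d), ℝ)) (x : EuclideanSpace ℝ (Fin d)) {c : ℝ} (hc : 0 < c) :
    Tendsto (fun n => φ (x + c • escapeVector e n)) atTop (𝓝 0) := by
  refine (zero_at_infty φ).comp ?_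
  rw [← Metric.cobounded_eq_cocompact, ← tendsto_norm_atTop_iff_cobounded]
  have hlow : ∀ n : ℕ, c * ((n : ℝ) + 1) - ‖x‖ ≤ ‖x + c • escapeVector e n‖ := fun n => by
    have h1 : ‖c • escapeVector e n‖ = c * ((n : ℝ) + 1) := by
      rw [escapeVector, norm_smul, norm_smul, he, Real.norm_of_nonneg hc.le,
        Real.norm_of_nonneg (by positivity), mul_one]
    have h2 := norm_sub_le (x + c • escapeVector e n) x
    rw [add_sub_cancel_left, h1] at h2
    linarith
  refine tendsto_atTop_mono hlow (tendsto_atTop_add_const_right _ _ ?_)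
  exact (tendsto_atTop_add_const_right _ _ tendsto_natCast_atTop_atTop).const_mul_atTop hc

lemma tendsto_integral_escape {e : EuclideanSpace ℝ (Fin d)} (he : ‖e‖ = 1)
    (ρ : Measure (EuclideanSpace ℝ (Fin d))) [IsFiniteMeasure ρ]
    (φ : C₀(EuclideanSpace ℝ (Fin d), ℝ)) {c : ℝ} (hc : 0 < c) :
    Tendsto (fun n => ∫ x, φ (x + c • escapeVector e n) ∂ρ) atTop (𝓝 0) := by
  have h := tendsto_integral_of_dominated_convergence (μ := ρ)
    (F := fun n x => φ (x + c • escapeVector e n)) (f := fun _ => 0) (fun _ => ‖φ.toBCF‖)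
    (fun n => (φ.continuous.comp (continuous_add_const _)).aestronglyMeasurable)
    (integrable_const _)
    (fun n => Eventually.of_forall fun x => φ.toBCF.norm_coe_le_norm _)
    (Eventually.of_forall fun x => tendsto_zeroAtInfty_escape he φ x hc)
  simpa using h

/-- The padding mass sits at `escapeVector e n` rather than at a fixed point, so that even its copy
with `k = 0` escapes. -/
lemma weakStarTendsto_translateSum (hN : 1 ≤ N) {e : EuclideanSpace ℝ (Fin d)} (he : ‖e‖ = 1)
    (ρ : Measure (EuclideanSpace ℝ (Fin d))) [IsFiniteMeasure ρ] {a : ℝ≥0∞} (ha : a ≠ ∞) :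
    WeakStarTendsto (fun n => translateSum N (ρ + a • Measure.dirac (escapeVector e n))
      (escapeVector e n)) ρ := by
  intro φ
  have hfin : ∀ n, IsFiniteMeasure (a • Measure.dirac (escapeVector e n)) := fun n =>
    Measure.smul_finite _ ha
  have heq : ∀ n, ∫ x, φ x ∂translateSum N (ρ + a • Measure.dirac (escapeVector e n))
      (escapeVector e n) = ∑ k : Fin N, (∫ x, φ (x + (k : ℝ) • escapeVector e n) ∂ρ
        + a.toReal * φ (0 + ((k : ℝ) + 1) • escapeVector e n)) := fun n => by
    have hint : ∀ (k : Fin N) (μ : Measure (EuclideanSpace ℝ (Fin d))) [IsFiniteMeasure μ],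
        Integrable (fun x => φ (x + (k : ℝ) • escapeVector e n)) μ := fun k μ _ =>
      (φ.toBCF.compContinuous ⟨_, continuous_add_const ((k : ℝ) • escapeVector e n)⟩).integrable μ
    have := hfin n
    rw [integral_translateSum]
    refine Finset.sum_congr rfl fun k _ => ?_
    rw [integral_add_measure (hint k _) (hint k _), integral_smul_measure, integral_dirac,
      smul_eq_mul, zero_add, add_smul, one_smul, add_comm (escapeVector e n)]
  simp only [heq]
  have hlim : ∫ x, φ x ∂ρ = ∑ k : Fin N, ((if (k : ℕ) = 0 then ∫ x, φ x ∂ρ else 0)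
      + a.toReal * 0) := by
    obtain ⟨m, rfl⟩ : ∃ m, N = m + 1 := ⟨N - 1, by omega⟩
    simp
  rw [hlim]
  refine tendsto_finsetSum _ fun k _ => Tendsto.add ?_
    ((tendsto_zeroAtInfty_escape he φ 0 (by positivity)).const_mul _)
  by_cases hk : (k : ℕ) = 0
  · simp [hk]
  · rw [if_neg hk]
    exact tendsto_integral_escape he ρ φ (by exact_mod_cast Nat.pos_of_ne_zero hk)

lemma relaxedCost_eq_zero_of_measure_univ_le (hd : 1 ≤ d) (hN : 1 ≤ N)
    {ρ : Measure (EuclideanSpace ℝ (Fin d))} [IsFiniteMeasure ρ]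
    (h : ρ Set.univ ≤ 1 / (N : ℝ≥0∞)) : relaxedCost N ρ = 0 := by
  have : NeZero N := ⟨by omega⟩
  have hN0 : (N : ℝ≥0∞) ≠ 0 := by exact_mod_cast (by omega : N ≠ 0)
  obtain ⟨e, he⟩ : ∃ e : EuclideanSpace ℝ (Fin d), ‖e‖ = 1 :=
    ⟨EuclideanSpace.single ⟨0, hd⟩ 1, by simp⟩
  -- The mass missing from `1 / N`; the truncated subtraction is exact by `h`.
  set a : ℝ≥0∞ := 1 / (N : ℝ≥0∞) - ρ Set.univ with ha_def
  have ha : a ≠ ∞ := ENNReal.sub_ne_top (by simp [hN0])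
  have hmass : ∀ n, N * (ρ + a • Measure.dirac (escapeVector e n)) Set.univ = 1 := fun n => by
    simp only [Measure.coe_add, Pi.add_apply, Measure.smul_apply, measure_univ, smul_eq_mul,
      mul_one]
    rw [ha_def, add_tsub_cancel_of_le h, one_div,
      ENNReal.mul_inv_cancel hN0 (ENNReal.natCast_ne_top N)]
  have hbound : Tendsto (fun n => (N : ℝ≥0∞) * N * ‖escapeVector e n‖ₑ⁻¹) atTop (𝓝 0) := by
    have hnorm : ∀ n, ‖escapeVector e n‖ₑ = ((n + 1 : ℕ) : ℝ≥0∞) := fun n => by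
      rw [← ofReal_norm, escapeVector, norm_smul, he, mul_one,
        Real.norm_of_nonneg (by positivity)]
      exact_mod_cast ENNReal.ofReal_natCast (n + 1)
    simp only [hnorm]
    have := ENNReal.Tendsto.const_mul (a := (N : ℝ≥0∞) * N)
      ((tendsto_add_atTop_iff_nat 1).2 ENNReal.tendsto_inv_nat_nhds_zero)
      (Or.inr (ENNReal.mul_ne_top (ENNReal.natCast_ne_top N) (ENNReal.natCast_ne_top N)))
    simpa using this
  refine le_antisymm ?_ zero_le
  calc relaxedCost N ρ
      ≤ liminf (fun n => multimarginalCost N (translateSum N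
          (ρ + a • Measure.dirac (escapeVector e n)) (escapeVector e n))) atTop :=
        iInf_le_of_le _ (iInf_le_of_le
          (fun n => isProbabilityMeasure_translateSum (hmass n) (escapeVector e n))
          (iInf_le _ (weakStarTendsto_translateSum hN he ρ ha)))
    _ ≤ liminf (fun n => (N : ℝ≥0∞) * N * ‖escapeVector e n‖ₑ⁻¹) atTop :=
        liminf_le_liminf (Eventually.of_forall fun n =>
          multimarginalCost_translateSum_le (hmass n) _)
    _ = 0 := hbound.liminf_eq

end Sufficiency

theorem mainTheorem8 (d N : ℕ) (hd : 1 ≤ d) (hN : 1 ≤ N)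
    (ρ : Measure (EuclideanSpace ℝ (Fin d))) (hρ : ρ ∈ subProbabilities d) :
    relaxedCost N ρ = 0 ↔ ρ Set.univ ≤ 1 / (N : ℝ≥0∞) := by
  have : IsFiniteMeasure ρ := ⟨lt_of_le_of_lt hρ ENNReal.one_lt_top⟩
  exact ⟨measure_univ_le_of_relaxedCost_eq_zero hN, relaxedCost_eq_zero_of_measure_univ_le hd hN⟩
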